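/- **Theorem.** Let $n\ge 1$ and let $A=\{a_0,\dots,a_{n+1}\}\subset\mathbb R^n$ be a set of $n+2$ distinct points that is not contained in an affine hyperplane. For $x$ near $\mathbf 1=(1,\dots,1)\in\mathbb C^n$ write $x^{a}=\prod_{i=1}^n x_i^{a_i}$, where $x_i^{a_i}=e^{a_i\log x_i}$ with the principal branch of the logarithm. For a matrix $C=(c_{kj})\in\mathbb C^{n\times(n+2)}$ let $C\cdot x^A=0$ be the system $f_k(x)=\sum_{j=0}^{n+1}c_{kj}x^{a_j}=0$, $k=1,\dots,n$; the multiplicity of $\mathbf 1$ as a solution of it is $\dim_{\mathbb C}\mathcal O_{\mathbf 1}/(f_1,\dots,f_n)$, where $\mathcal O_{\mathbf 1}$ is the ring of germs at $\mathbf 1$ of analytic functions on $\mathbb C^n$. For a field $K$ let $\gamma:K\to K^n$, $\gamma(t)=(t,t^2,\dots,t^n)$. 1. Let $C\in\mathbb C^{n\times(n+2)}$ have rank $n$. Then $\mathbf 1$ is a solution of $C\cdot x^A=0$ of multiplicity $n+1$ if and only if the kernel of $C$ contains the vector $(1,\dots,1)$ and a vector $(d_0,\dots,d_{n+1})\in\mathbb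 C^{n+2}$ with pairwise distinct coordinates such that some invertible affine transformation of $\mathbb C^n$ maps $a_j$ to $\gamma(d_j)$ for every $j=0,\dots,n+1$. 2. Let $C\in\mathbb R^{n\times(n+2)}$ have rank $n$. Then $\mathbf 1$ is a solution of $C\cdot x^A=0$ of multiplicity $n+1$ if and only if the kernel of $C$ contains the vector $(1,\dots,1)$ and a vector $(d_0,\dots,d_{n+1})\in\mathbb R^{n+2}$ with pairwise distinct coordinates such that some invertible affine transformation of $\mathbb R^n$ maps $a_j$ to $\gamma(d_j)$ for every $j=0,\dots,n+1$. -/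

import Mathlib

open scoped Topology

/-- The `ℂ`-algebra structure on germs of functions, with its usual scalar multiplication. -/
noncomputable instance germAlgebra {X : Type*} (l : Filter X) : Algebra ℂ (Filter.Germ l ℂ) :=
  Algebra.ofModule
    (fun c f g => Filter.Germ.inductionOn₂ f g fun f g =>
      congrArg (fun h : X → ℂ => (h : Filter.Germ l ℂ)) (smul_mul_assoc c f g))
    (fun c f g => Filter.Germ.inductionOn₂ f g fun f g =>
      congrArg (fun h : X → ℂ => (h : Filter.Germ l ℂ)) (mul_smul_comm c f g))

/-- The ring `𝒪_q` of germs at `q ∈ ℂⁿ` of complex analytic functions, as a `ℂ`-subalgebra of the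
algebra of all germs at `q` of functions `ℂⁿ → ℂ`. -/
noncomputable def analyticGerms {n : ℕ} (q : Fin n → ℂ) :
    Subalgebra ℂ (Filter.Germ (𝓝 q) ℂ) where
  carrier := {g | ∃ f : (Fin n → ℂ) → ℂ, AnalyticAt ℂ f q ∧ (f : Filter.Germ (𝓝 q) ℂ) = g}
  mul_mem' := by
    rintro _ _ ⟨f, hf, rfl⟩ ⟨g, hg, rfl⟩
    exact ⟨f * g, hf.mul hg, rfl⟩
  add_mem' := by
    rintro _ _ ⟨f, hf, rfl⟩ ⟨g, hg, rfl⟩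
    exact ⟨f + g, hf.add hg, rfl⟩
  algebraMap_mem' := fun c => ⟨c • 1, analyticAt_const.smul analyticAt_const, by
    rw [Algebra.algebraMap_eq_smul_one]; rfl⟩

/-- The germ at `q` of a function that is analytic at `q`. -/
noncomputable def analyticGerm {n : ℕ} {q : Fin n → ℂ} (f : (Fin n → ℂ) → ℂ) (hf : AnalyticAt ℂ f q) :
    analyticGerms q :=
  ⟨(f : Filter.Germ (𝓝 q) ℂ), f, hf, rfl⟩

/-- The local intersection multiplicity at `q ∈ ℂⁿ` of the system `f₁ = ⋯ = fᵣ = 0`, where the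
`f_k` are analytic at `q`: the dimension over `ℂ` of `𝒪_q / (f₁, …, fᵣ)`.
It is an infinite cardinal if `q` is a non-isolated solution, and `0` if `q` is not a solution. -/
noncomputable def localMultiplicity {n r : ℕ} (q : Fin n → ℂ)
    (f : Fin r → (Fin n → ℂ) → ℂ) (hf : ∀ k, AnalyticAt ℂ (f k) q) : Cardinal :=
  Module.rank ℂ
    (analyticGerms q ⧸ Ideal.span (Set.range fun k => analyticGerm (f k) (hf k)))

/-- The monomial function `x^a = ∏ᵢ xᵢ^{aᵢ} = ∏ᵢ exp (aᵢ log xᵢ)` with real exponent vector `a`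
(principal branch, so that `1^a = 1`). -/
noncomputable def monomialFun {n : ℕ} (a : Fin n → ℝ) (x : Fin n → ℂ) : ℂ :=
  ∏ i, x i ^ (a i : ℂ)

/-- The system `C · x^A`: its `k`-th function is `f_k(x) = ∑ⱼ c_{kj} x^{a_j}`. -/
noncomputable def sparseSystem {n r N : ℕ} (C : Matrix (Fin r) (Fin N) ℂ)
    (a : Fin N → Fin n → ℝ) (k : Fin r) (x : Fin n → ℂ) : ℂ :=
  ∑ j, C k j * monomialFun (a j) x

theorem analyticAt_monomialFun_one {n : ℕ} (a : Fin n → ℝ) :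
    AnalyticAt ℂ (monomialFun a) (1 : Fin n → ℂ) := by
  unfold monomialFun
  refine Finset.analyticAt_fun_prod _ fun i _ => ?_
  refine AnalyticAt.cpow ?_ analyticAt_const (by simp)
  exact (ContinuousLinearMap.proj (R := ℂ) (φ := fun _ : Fin n => ℂ) i).analyticAt _

theorem analyticAt_sparseSystem_one {n r N : ℕ} (C : Matrix (Fin r) (Fin N) ℂ)
    (a : Fin N → Fin n → ℝ) (k : Fin r) :
    AnalyticAt ℂ (sparseSystem C a k) (1 : Fin n → ℂ) := by
  unfold sparseSystem
  exact Finset.analyticAt_fun_sum _ fun j _ =>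
    analyticAt_const.mul (analyticAt_monomialFun_one (a j))

/-- The multiplicity of the point `𝟏 = (1, …, 1)` as a solution of the system `C · x^A = 0`. -/
noncomputable def multiplicityAtOne {n r N : ℕ} (C : Matrix (Fin r) (Fin N) ℂ)
    (a : Fin N → Fin n → ℝ) : Cardinal :=
  localMultiplicity (1 : Fin n → ℂ) (sparseSystem C a) (analyticAt_sparseSystem_one C a)

/-- The moment curve `γ(t) = (t, t², …, tⁿ)`. -/
def momentCurve {K : Type*} [Field K] (n : ℕ) (t : K) : Fin n → K :=
  fun i => t ^ ((i : ℕ) + 1)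

/-- The labelled configurations `p` and `p'` in `Kⁿ` are equal up to an (invertible) affine
transformation of `Kⁿ`. -/
def AffinelyEquivalent {K : Type*} [Field K] {n N : ℕ} (p p' : Fin N → Fin n → K) : Prop :=
  ∃ T : (Fin n → K) ≃ᵃ[K] (Fin n → K), ∀ j, T (p j) = p' j

/-! If `C` has rank n and kills `𝟏`, its kernel is spanned by `𝟏` and a nonconstant vector d, so a
solution near `𝟏` has x^{a_j} = s(1 + t d_j). By logarithms, log s + log(1 + t d_j) is the linear
form log x evaluated at a_j. An affine relation b of the points kills affine functions, which leaves
one equation H(t) = ∑ b_j log(1 + t d_j) = 0, while t determines x. The t^k coefficient of H is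
±(1/k) ∑ b_j d_j^k, so the multiplicity is the index of the first nonzero moment ∑ b_j d_j^k
(`multiplicityAtOne_eq_iff`).

No isomorphism with ℂ{t}/(H) is built. From above (`multiplicityAtOne_le`), the germ τ = `param`
generates the maximal ideal modulo the system and τ^m lies in the system's ideal. From below
(`le_multiplicityAtOne`), a curve solving the system to order M detects that 1, τ, …, τ^{M-1} are
independent.

Multiplicity n+1 thus means that moments 0 to n vanish and moment n+1 does not. Vectors orthogonal
to b are exactly the affine functions on the configuration, so the vanishing says that d, …, d^n are
affine in a. Vandermonde arguments then handle invertibility of the map and distinctness of the d_j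
(`moments_iff_affinelyEquivalent`). -/

/-! ### Ideals of analytic germs -/

section AnalyticGerms

open Filter

variable {n : ℕ} {q : Fin n → ℂ}

/-- The function `f` is analytic at `q` and its germ lies in the ideal `I`. -/
def IsGermIn (I : Ideal (analyticGerms q)) (f : (Fin n → ℂ) → ℂ) : Prop :=
  ∃ hf : AnalyticAt ℂ f q, analyticGerm f hf ∈ I

theorem analyticGerm_congr {f g : (Fin n → ℂ) → ℂ} (hf : AnalyticAt ℂ f q)
    (hg : AnalyticAt ℂ g q) (h : f =ᶠ[𝓝 q] g) : analyticGerm f hf = analyticGerm g hg :=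
  Subtype.ext (Filter.Germ.coe_eq.mpr h)

theorem exists_analyticGerm_eq (x : analyticGerms q) :
    ∃ (f : (Fin n → ℂ) → ℂ) (hf : AnalyticAt ℂ f q), analyticGerm f hf = x := by
  obtain ⟨g, f, hf, rfl⟩ := x
  exact ⟨f, hf, rfl⟩

namespace IsGermIn

variable {I J : Ideal (analyticGerms q)} {f g : (Fin n → ℂ) → ℂ}

theorem congr (hf : IsGermIn I f) (h : f =ᶠ[𝓝 q] g) : IsGermIn I g := by
  obtain ⟨hf, hfI⟩ := hf
  refine ⟨hf.congr h, ?_⟩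
  rwa [← analyticGerm_congr hf (hf.congr h) h]

theorem mono (hf : IsGermIn I f) (h : I ≤ J) : IsGermIn J f :=
  hf.imp fun _ hfI => h hfI

theorem add (hf : IsGermIn I f) (hg : IsGermIn I g) : IsGermIn I (fun x => f x + g x) := by
  obtain ⟨hf, hfI⟩ := hf
  obtain ⟨hg, hgI⟩ := hg
  exact ⟨hf.add hg, I.add_mem hfI hgI⟩

theorem mul_left (hg : AnalyticAt ℂ g q) (hf : IsGermIn I f) :
    IsGermIn I (fun x => g x * f x) := by
  obtain ⟨hf, hfI⟩ := hf
  exact ⟨hg.mul hf, I.mul_mem_left (analyticGerm g hg) hfI⟩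

theorem const_mul (c : ℂ) (hf : IsGermIn I f) : IsGermIn I (fun x => c * f x) :=
  mul_left analyticAt_const hf

theorem zero : IsGermIn I (fun _ => 0) := ⟨analyticAt_const, I.zero_mem⟩

theorem sum {ι : Type*} (s : Finset ι) {F : ι → (Fin n → ℂ) → ℂ}
    (h : ∀ i ∈ s, IsGermIn I (F i)) : IsGermIn I (fun x => ∑ i ∈ s, F i x) := by
  classical
  induction s using Finset.induction_on with
  | empty => simpa using zero
  | insert i s hi ih =>
    simp only [Finset.sum_insert hi]
    exact (h i (by simp)).add (ih fun j hj => h j (by simp [hj]))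

/-- A univariate analytic function vanishing at `0` maps germs in `I` to germs in `I`. -/
theorem comp {h : ℂ → ℂ} (hh : AnalyticAt ℂ h 0) (h0 : h 0 = 0) (hf : IsGermIn I f)
    (hfq : f q = 0) : IsGermIn I (fun x => h (f x)) := by
  -- Since h vanishes at 0, h(z) = z · `dslope h 0 z`, so h ∘ f is an analytic multiple of f.
  have hd : AnalyticAt ℂ (dslope h 0) 0 := by
    obtain ⟨p, hp⟩ := hh
    exact hp.has_fpower_series_dslope_fslope.analyticAt
  obtain ⟨hfa, hfI⟩ := hf
  have h2 : AnalyticAt ℂ (fun x => dslope h 0 (f x)) q :=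
    AnalyticAt.fun_comp (by rwa [hfq]) hfa
  refine (mul_left h2 ⟨hfa, hfI⟩).congr (.of_forall fun x => ?_)
  have := sub_smul_dslope h 0 (f x)
  simp only [sub_zero, h0, smul_eq_mul] at this
  simp only [← this, mul_comm]

end IsGermIn

theorem analyticAt_log_one_add : AnalyticAt ℂ (fun z : ℂ => Complex.log (1 + z)) 0 :=
  (analyticAt_const.add analyticAt_id).clog (by simp)

/-- Congruent units have congruent logarithms. -/
theorem IsGermIn.log_sub_log {I : Ideal (analyticGerms q)} {u v : (Fin n → ℂ) → ℂ}
    (hu : AnalyticAt ℂ u q) (hv : AnalyticAt ℂ v q) (hu1 : u q = 1) (hv1 : v q = 1)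
    (h : IsGermIn I (fun x => u x - v x)) :
    IsGermIn I (fun x => Complex.log (u x) - Complex.log (v x)) := by
  have hinv : AnalyticAt ℂ (fun x => (v x)⁻¹) q := hv.inv (by simp [hv1])
  -- Near q, log u - log v = log(1 + v⁻¹(u - v)); the bound on the imaginary part below keeps this
  -- on the principal branch.
  have h1 := (IsGermIn.mul_left hinv h).comp analyticAt_log_one_add (by simp)
    (by simp [hu1, hv1])
  refine h1.congr ?_
  have hlu : ContinuousAt (fun x => Complex.log (u x)) q :=
    (hu.clog (by simp [hu1])).continuousAt
  have hlv : ContinuousAt (fun x => Complex.log (v x)) q :=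
    (hv.clog (by simp [hv1])).continuousAt
  have hsub : ContinuousAt (fun x => (Complex.log (u x) - Complex.log (v x)).im) q :=
    Complex.continuous_im.continuousAt.comp (hlu.sub hlv)
  have hev : ∀ᶠ x in 𝓝 q, |(Complex.log (u x) - Complex.log (v x)).im| < Real.pi := by
    have h0 : |(Complex.log (u q) - Complex.log (v q)).im| < Real.pi := by
      simp [hu1, hv1, Real.pi_pos]
    exact hsub.abs.eventually_lt continuousAt_const h0
  filter_upwards [hev, hu.continuousAt.eventually_ne (y := 0) (by simp [hu1]),
    hv.continuousAt.eventually_ne (y := 0) (by simp [hv1])] with x hx hux hvx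
  have : 1 + (v x)⁻¹ * (u x - v x) = Complex.exp (Complex.log (u x) - Complex.log (v x)) := by
    rw [Complex.exp_sub, Complex.exp_log hux, Complex.exp_log hvx]
    field_simp
    ring
  rw [this, Complex.log_exp (abs_lt.mp hx).1 (abs_lt.mp hx).2.le]

/-- An ideal containing the coordinate functions contains every germ vanishing at the point. -/
theorem IsGermIn.sub_apply_of_coordinates {I : Ideal (analyticGerms q)}
    (hI : ∀ i, IsGermIn I (fun x => x i - q i)) {f : (Fin n → ℂ) → ℂ} (hf : AnalyticAt ℂ f q) :
    IsGermIn I (fun x => f x - f q) := by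
  obtain ⟨p, r, hp⟩ := hf
  -- The shifted series sums to a linear form G(x) with f(x) - f(q) = G(x)(x - q); expanding x - q
  -- in the standard basis gives analytic coefficients of the x_i - q_i.
  have hr : 0 < p.shift.radius := by
    rw [FormalMultilinearSeries.radius_shift]
    exact hp.r_pos.trans_le hp.r_le
  have hs := p.shift.hasFPowerSeriesOnBall hr
  have hG : AnalyticAt ℂ (fun x => p.shift.sum (x - q)) q :=
    AnalyticAt.fun_comp (by simpa using hs.analyticAt)
      (analyticAt_id.sub analyticAt_const)
  have hGi : ∀ i, AnalyticAt ℂ (fun x => p.shift.sum (x - q) (Pi.single i 1)) q := fun i =>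
    ((ContinuousLinearMap.apply ℂ ℂ (Pi.single i (1 : ℂ) : Fin n → ℂ)).analyticAt _).fun_comp hG
  refine (IsGermIn.sum Finset.univ fun i _ => IsGermIn.mul_left (hGi i) (hI i)).congr ?_
  have hball : ∀ᶠ x in 𝓝 q, x - q ∈ Metric.eball (0 : Fin n → ℂ) (min r p.shift.radius) := by
    have : Tendsto (fun x => x - q) (𝓝 q) (𝓝 0) := by
      have : ContinuousAt (fun x => x - q) q := by fun_prop
      simpa [ContinuousAt] using this
    exact this (Metric.eball_mem_nhds _ (lt_min hp.r_pos hr))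
  filter_upwards [hball] with x hx
  have hx1 : x - q ∈ Metric.eball (0 : Fin n → ℂ) r :=
    Metric.eball_subset_eball (min_le_left _ _) hx
  have hx2 : x - q ∈ Metric.eball (0 : Fin n → ℂ) p.shift.radius :=
    Metric.eball_subset_eball (min_le_right _ _) hx
  have e1 := hp.hasSum hx1
  have e2 := hs.hasSum hx2
  rw [zero_add] at e2
  have e3 := (ContinuousLinearMap.apply ℂ ℂ (x - q)).hasSum e2
  have e4 := (hasSum_nat_add_iff' 1).mpr e1
  have e5 : p.shift.sum (x - q) (x - q) = f x - f q := by
    refine e3.unique ?_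
    convert e4 using 1
    · ext k
      simp only [FormalMultilinearSeries.shift, ContinuousLinearMap.apply_apply]
      rw [ContinuousMultilinearMap.curryRight_apply]
      congr 1
      ext i
      refine Fin.lastCases ?_ (fun i => ?_) i <;> simp
    · simp [hp.coeff_zero]
  rw [← e5]
  generalize p.shift.sum (x - q) = G
  conv_rhs => rw [pi_eq_sum_univ' (x - q)]
  simp only [map_sum, map_smul, smul_eq_mul, Pi.sub_apply, mul_comm]

end AnalyticGerms

/-- If every element of `R` is congruent to a constant modulo `(τ) + I` and `τ ^ m ∈ I`, then
`R / I` has dimension at most `m`. -/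
theorem rank_quotient_le_of_pow_mem {R : Type} [CommRing R] [Algebra ℂ R] (I : Ideal R) (τ : R)
    (hτ : ∀ f : R, ∃ c : ℂ, f - algebraMap ℂ R c ∈ Ideal.span {τ} ⊔ I) {m : ℕ}
    (hm : τ ^ m ∈ I) : Module.rank ℂ (R ⧸ I) ≤ m := by
  set w : Fin m → R ⧸ I := fun i => Ideal.Quotient.mk I τ ^ (i : ℕ) with hw
  -- Repeated division by τ: modulo I, f is a combination of 1, …, τ^{k-1} plus τ^k g.
  have key : ∀ k ≤ m, ∀ f : R, ∃ g : R,
      Ideal.Quotient.mk I f - Ideal.Quotient.mk I (τ ^ k * g) ∈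
        Submodule.span ℂ (Set.range w) := by
    intro k
    induction k with
    | zero => exact fun _ f => ⟨f, by simp⟩
    | succ k ih =>
      intro hk f
      obtain ⟨g, hg⟩ := ih (by omega) f
      obtain ⟨c, hc⟩ := hτ g
      obtain ⟨y, hy, z, hz, hyz⟩ := Submodule.mem_sup.mp hc
      obtain ⟨h, rfl⟩ := Ideal.mem_span_singleton'.mp hy
      refine ⟨h, ?_⟩
      have h1 : c • w ⟨k, hk⟩ ∈ Submodule.span ℂ (Set.range w) :=
        Submodule.smul_mem _ _ (Submodule.subset_span ⟨_, rfl⟩)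
      convert Submodule.add_mem _ hg h1 using 1
      have hg' : g = algebraMap ℂ R c + h * τ + z := by rw [add_assoc, hyz]; ring
      have hz0 : Ideal.Quotient.mk I z = 0 := Ideal.Quotient.eq_zero_iff_mem.mpr hz
      have hc' : Ideal.Quotient.mk I (algebraMap ℂ R c) = algebraMap ℂ (R ⧸ I) c := rfl
      rw [hg', Algebra.smul_def]
      simp only [hw, map_mul, map_add, map_pow, hz0, hc']
      ring
  have htop : Submodule.span ℂ (Set.range w) = ⊤ := by
    rw [eq_top_iff]
    rintro x -
    obtain ⟨f, rfl⟩ := Ideal.Quotient.mk_surjective x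
    obtain ⟨g, hg⟩ := key m le_rfl f
    rwa [Ideal.Quotient.eq_zero_iff_mem.mpr (I.mul_mem_right g hm), sub_zero] at hg
  rw [← rank_top, ← htop]
  refine (rank_span_le _).trans ?_
  simpa using Cardinal.mk_range_le (f := w)

/-! ### Logarithms of monomials and the order of vanishing of weighted log sums -/

section Auxiliary

open Filter Asymptotics

theorem eventually_log_mul {X : Type*} [TopologicalSpace X] {q : X} {u v : X → ℂ}
    (hu : ContinuousAt u q) (hv : ContinuousAt v q) (hu1 : u q = 1) (hv1 : v q = 1) :
    ∀ᶠ x in 𝓝 q, Complex.log (u x * v x) = Complex.log (u x) + Complex.log (v x) := by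
  have hlu : ContinuousAt (fun x => Complex.log (u x)) q := hu.clog (by simp [hu1])
  have hlv : ContinuousAt (fun x => Complex.log (v x)) q := hv.clog (by simp [hv1])
  have hadd : ContinuousAt (fun x => (Complex.log (u x) + Complex.log (v x)).im) q :=
    Complex.continuous_im.continuousAt.comp (hlu.add hlv)
  have hev : ∀ᶠ x in 𝓝 q, |(Complex.log (u x) + Complex.log (v x)).im| < Real.pi :=
    hadd.abs.eventually_lt continuousAt_const (by simp [hu1, hv1, Real.pi_pos])
  filter_upwards [hev, hu.eventually_ne (y := 0) (by simp [hu1]),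
    hv.eventually_ne (y := 0) (by simp [hv1])] with x hx hux hvx
  rw [← Complex.log_exp (abs_lt.mp hx).1 (abs_lt.mp hx).2.le, Complex.exp_add,
    Complex.exp_log hux, Complex.exp_log hvx]

theorem eventually_log_exp {X : Type*} [TopologicalSpace X] {q : X} {u : X → ℂ}
    (hu : ContinuousAt u q) (hu0 : u q = 0) :
    ∀ᶠ x in 𝓝 q, Complex.log (Complex.exp (u x)) = u x := by
  have him : ContinuousAt (fun x => (u x).im) q := Complex.continuous_im.continuousAt.comp hu
  have hev : ∀ᶠ x in 𝓝 q, |(u x).im| < Real.pi :=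
    him.abs.eventually_lt continuousAt_const (by simp [hu0, Real.pi_pos])
  filter_upwards [hev] with x hx
  exact Complex.log_exp (abs_lt.mp hx).1 (abs_lt.mp hx).2.le

theorem monomialFun_one {n : ℕ} (a : Fin n → ℝ) : monomialFun a 1 = 1 := by
  simp [monomialFun]

/-- Near `0`, a monomial in `exp ∘ w` is the exponential of a linear form in `w`. -/
theorem eventually_monomialFun_exp {X : Type*} [TopologicalSpace X] {q : X} {n : ℕ}
    (a : Fin n → ℝ) {w : Fin n → X → ℂ} (hw : ∀ i, ContinuousAt (w i) q) (hw0 : ∀ i, w i q = 0) :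
    ∀ᶠ x in 𝓝 q, monomialFun a (fun i => Complex.exp (w i x)) =
      Complex.exp (∑ i, (a i : ℂ) * w i x) := by
  filter_upwards [eventually_all.mpr fun i => eventually_log_exp (hw i) (hw0 i)] with x hx
  unfold monomialFun
  rw [Complex.exp_sum]
  refine Finset.prod_congr rfl fun i _ => ?_
  rw [Complex.cpow_def_of_ne_zero (Complex.exp_ne_zero _), hx i, mul_comm]

theorem continuousAt_log_apply {n : ℕ} (i : Fin n) :
    ContinuousAt (fun x : Fin n → ℂ => Complex.log (x i)) 1 :=
  (continuous_apply i).continuousAt.clog (by simp)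

theorem eventually_log_monomialFun {n : ℕ} (a : Fin n → ℝ) :
    ∀ᶠ x in 𝓝 (1 : Fin n → ℂ),
      Complex.log (monomialFun a x) = ∑ i, (a i : ℂ) * Complex.log (x i) := by
  have hc : ContinuousAt (fun x : Fin n → ℂ => ∑ i, (a i : ℂ) * Complex.log (x i)) 1 :=
    tendsto_finsetSum _ fun i _ => continuousAt_const.mul (continuousAt_log_apply i)
  have hne : ∀ i, ∀ᶠ x in 𝓝 (1 : Fin n → ℂ), x i ≠ 0 := fun i =>
    (continuous_apply i).continuousAt.eventually_ne (by simp)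
  filter_upwards [eventually_log_exp hc (by simp),
    eventually_monomialFun_exp a continuousAt_log_apply (by simp),
    eventually_all.mpr hne] with x h1 h2 h3
  rw [← h1, ← h2]
  congr 2
  ext i
  rw [Complex.exp_log (h3 i)]

/-- The weighted sum of logarithms `∑ⱼ bⱼ log (1 + t dⱼ)`. -/
noncomputable def logSum {ι : Type*} [Fintype ι] (b d : ι → ℂ) (t : ℂ) : ℂ :=
  ∑ j, b j * Complex.log (1 + t * d j)

section LogSum

variable {ι : Type*} [Fintype ι] (b d : ι → ℂ)

theorem analyticAt_log_one_add_mul (c : ℂ) :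
    AnalyticAt ℂ (fun t : ℂ => Complex.log (1 + t * c)) 0 :=
  (analyticAt_const.add (analyticAt_id.mul analyticAt_const)).clog (by simp)

theorem analyticAt_logSum : AnalyticAt ℂ (logSum b d) 0 :=
  Finset.analyticAt_fun_sum _ fun j _ => analyticAt_const.mul (analyticAt_log_one_add_mul (d j))

@[simp] theorem logSum_zero : logSum b d 0 = 0 := by simp [logSum]

variable {b d}

/-- The t^k Taylor coefficient is (-1)^{k+1}/k times the k-th moment, so the vanishing moments leave
only the t^m term. -/
theorem logSum_sub_isBigO {m : ℕ} (h : ∀ k < m, ∑ j, b j * d j ^ k = 0) :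
    (fun t => logSum b d t - (-1) ^ (m + 1) / m * (∑ j, b j * d j ^ m) * t ^ m)
      =O[𝓝 0] fun t => t ^ (m + 1) := by
  have h1 : ∀ j, (fun t : ℂ => Complex.log (1 + t * d j) - Complex.logTaylor (m + 1) (t * d j))
      =O[𝓝 0] fun t => t ^ (m + 1) := by
    intro j
    have ht : Tendsto (fun t : ℂ => t * d j) (𝓝 0) (𝓝 0) := by
      have : ContinuousAt (fun t : ℂ => t * d j) 0 := by fun_prop
      simpa [ContinuousAt] using this
    refine ((Complex.log_sub_logTaylor_isBigO m).comp_tendsto ht).trans ?_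
    refine IsBigO.of_bound (‖d j‖ ^ (m + 1)) (.of_forall fun t => ?_)
    simp [mul_pow, mul_comm]
  have h2 := IsBigO.sum (s := Finset.univ) fun j _ => (h1 j).const_mul_left (b j)
  refine h2.congr_left fun t => ?_
  simp only [Finset.sum_apply, mul_sub, Finset.sum_sub_distrib, logSum]
  congr 1
  simp only [Complex.logTaylor, Finset.mul_sum]
  rw [Finset.sum_comm, Finset.sum_range_succ, Finset.sum_eq_zero, zero_add, Finset.sum_mul]
  · refine Finset.sum_congr rfl fun j _ => ?_
    ring
  · intro k hk
    trans (-1) ^ (k + 1) / k * t ^ k * ∑ j, b j * d j ^ k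
    · rw [Finset.mul_sum]
      refine Finset.sum_congr rfl fun j _ => ?_
      ring
    · rw [h k (Finset.mem_range.mp hk), mul_zero]

theorem logSum_isBigO {m : ℕ} (h : ∀ k < m, ∑ j, b j * d j ^ k = 0) :
    logSum b d =O[𝓝 0] fun t => t ^ m := by
  have h1 : (fun t : ℂ => t ^ (m + 1)) =O[𝓝 0] fun t => t ^ m := by
    simp only [pow_succ]
    have : (fun t : ℂ => t) =O[𝓝 0] fun _ => (1 : ℂ) :=
      (continuousAt_id (x := (0 : ℂ))).tendsto.isBigO_one ℂ
    simpa using (isBigO_refl (fun t : ℂ => t ^ m) (𝓝 0)).mul this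
  have h2 := ((logSum_sub_isBigO h).trans h1).add
    ((isBigO_refl (fun t : ℂ => t ^ m) (𝓝 0)).const_mul_left
      ((-1) ^ (m + 1) / m * ∑ j, b j * d j ^ m))
  exact h2.congr_left fun t => by ring

end LogSum

/-- A polynomial of degree less than `M` that is `O(t ^ M)` at `0` vanishes. -/
theorem eq_zero_of_sum_pow_isBigO {M : ℕ} {c : ℕ → ℂ}
    (h : (fun t : ℂ => ∑ i ∈ Finset.range M, c i * t ^ i) =O[𝓝[≠] 0] fun t => t ^ M) :
    ∀ i < M, c i = 0 := by
  induction M generalizing c with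
  | zero => simp
  | succ M ih =>
    have h0 : c 0 = 0 := by
      have h1 : Tendsto (fun t : ℂ => t ^ (M + 1)) (𝓝[≠] 0) (𝓝 0) := by
        have : ContinuousAt (fun t : ℂ => t ^ (M + 1)) 0 := by fun_prop
        simpa [ContinuousAt] using this.tendsto.mono_left nhdsWithin_le_nhds
      have h2 : Tendsto (fun t : ℂ => ∑ i ∈ Finset.range (M + 1), c i * t ^ i) (𝓝[≠] 0)
          (𝓝 (c 0)) := by
        have : ContinuousAt (fun t : ℂ => ∑ i ∈ Finset.range (M + 1), c i * t ^ i) 0 := by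
          fun_prop
        simpa [ContinuousAt, Finset.sum_range_succ'] using
          this.tendsto.mono_left nhdsWithin_le_nhds
      exact tendsto_nhds_unique h2 (h.trans_tendsto h1)
    intro i hi
    cases i with
    | zero => exact h0
    | succ i =>
      refine ih (c := fun i => c (i + 1)) ?_ i (by omega)
      -- The constant term is gone, so divide by t, which is invertible on the punctured
      -- neighbourhood.
      have h1 := (isBigO_refl (fun t : ℂ => t⁻¹) (𝓝[≠] 0)).mul h
      refine h1.congr' ?_ ?_ <;> filter_upwards [self_mem_nhdsWithin] with t ht
      · rw [Finset.sum_range_succ', h0, zero_mul, add_zero, Finset.mul_sum]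
        refine Finset.sum_congr rfl fun i _ => ?_
        rw [pow_succ]
        field_simp [show t ≠ 0 from ht]
      · rw [pow_succ', inv_mul_cancel_left₀ ht]

/-- The nonzero t^m coefficient forces an order of vanishing k ≤ m. Writing the sum as t^k times a
unit u, one takes g = t^{m-k} u⁻¹. -/
theorem exists_pow_eq_of_logSum {ι : Type*} [Fintype ι] {b d : ι → ℂ} {m : ℕ}
    (h : ∀ k < m, ∑ j, b j * d j ^ k = 0) (hm0 : m ≠ 0) (hm : ∑ j, b j * d j ^ m ≠ 0) :
    ∃ g : ℂ → ℂ, AnalyticAt ℂ g 0 ∧ ∀ᶠ t in 𝓝 0, t ^ m = g t * logSum b d t := by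
  have hno : ¬ logSum b d =O[𝓝 0] fun t => t ^ (m + 1) := by
    intro hO
    have h1 := hO.sub (logSum_sub_isBigO h)
    have h2 := eq_zero_of_sum_pow_isBigO (M := m + 1)
      (c := fun i => if i = m then (-1) ^ (m + 1) / m * (∑ j, b j * d j ^ m) else 0)
      ((h1.congr_left fun t => by simp).mono nhdsWithin_le_nhds) m (by omega)
    simp [hm0, hm] at h2
  rcases hord : analyticOrderAt (logSum b d) 0 with _ | k
  · exfalso
    have := analyticOrderAt_eq_top.mp hord
    exact hno ((isBigO_zero _ _).congr' (this.mono fun t ht => ht.symm) .rfl)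
  · obtain ⟨g, hg, hg0, hgt⟩ := (analyticAt_logSum b d).analyticOrderAt_eq_natCast.mp hord
    have hk : k ≤ m := by
      by_contra! hk
      apply hno
      have h1 : (fun t => t ^ (m + 1) * (t ^ (k - (m + 1)) * g t)) =O[𝓝 0]
          fun t : ℂ => t ^ (m + 1) * 1 := by
        refine (isBigO_refl _ _).mul ?_
        exact ((continuousAt_id.pow _).mul hg.continuousAt).tendsto.isBigO_one ℂ
      refine h1.congr' ?_ (.of_forall fun t => mul_one _)
      filter_upwards [hgt] with t ht
      rw [ht, sub_zero, smul_eq_mul, ← mul_assoc, ← pow_add]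
      congr 2
      omega
    refine ⟨fun t => t ^ (m - k) * (g t)⁻¹, (analyticAt_id.pow _).mul (hg.inv hg0), ?_⟩
    filter_upwards [hgt, hg.continuousAt.eventually_ne hg0] with t ht hgt0
    rw [ht, sub_zero, smul_eq_mul]
    field_simp
    rw [← pow_add]
    congr 1
    omega

end Auxiliary

/-! ### Reduction of the system to one univariate equation -/

section Circuit

open Filter Asymptotics

/-- A vector `d` which spans, together with `(1, …, 1)`, the kernel of `C`, an affine relation `b`
of the points `a_j`, and linear maps that witness the exactness of the corresponding sequences:
`C` has kernel `⟨1, d⟩`, with dual coordinates `α` and `β`, and the affine functions on the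
configuration are exactly the vectors orthogonal to `b`. -/
structure CircuitData {n : ℕ} (C : Matrix (Fin n) (Fin (n + 2)) ℂ) (a : Fin (n + 2) → Fin n → ℝ)
    (b d : Fin (n + 2) → ℂ) where
  E : Fin (n + 2) → Fin n → ℂ
  α : Fin (n + 2) → ℂ
  β : Fin (n + 2) → ℂ
  S : Fin n → Fin (n + 2) → ℂ
  σ : Fin (n + 2) → ℂ
  e : Fin (n + 2) → ℂ
  sum_C : ∀ k, ∑ j, C k j = 0
  sum_C_mul : ∀ k, ∑ j, C k j * d j = 0
  sum_α : ∑ j, α j = 1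
  sum_α_mul : ∑ j, α j * d j = 0
  sum_β : ∑ j, β j = 0
  sum_β_mul : ∑ j, β j * d j = 1
  eq_add_kernel : ∀ (z : Fin (n + 2) → ℂ) (j), z j =
    ∑ k, E j k * (∑ l, C k l * z l) + ∑ l, α l * z l + (∑ l, β l * z l) * d j
  sum_b : ∑ j, b j = 0
  sum_b_mul : ∀ i, ∑ j, b j * (a j i : ℂ) = 0
  sum_S : ∀ i, ∑ j, S i j = 0
  sum_S_mul : ∀ i l, ∑ j, S i j * (a j l : ℂ) = if i = l then 1 else 0
  eq_affine_add : ∀ (L : Fin (n + 2) → ℂ) (j), L j =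
    ∑ i, (a j i : ℂ) * (∑ k, S i k * L k) + ∑ k, σ k * L k + e j * ∑ k, b k * L k

namespace CircuitData

variable {n : ℕ} {C : Matrix (Fin n) (Fin (n + 2)) ℂ} {a : Fin (n + 2) → Fin n → ℝ}
  {b d : Fin (n + 2) → ℂ}

/-- The ideal of the system in the ring of analytic germs at `𝟏`. -/
noncomputable def systemIdeal (C : Matrix (Fin n) (Fin (n + 2)) ℂ) (a : Fin (n + 2) → Fin n → ℝ) :
    Ideal (analyticGerms (1 : Fin n → ℂ)) :=
  Ideal.span (Set.range fun k => analyticGerm (sparseSystem C a k)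
    (analyticAt_sparseSystem_one C a k))

/-- A linear combination of the monomials. -/
noncomputable def monomialSum (a : Fin (n + 2) → Fin n → ℝ) (φ : Fin (n + 2) → ℂ)
    (x : Fin n → ℂ) : ℂ :=
  ∑ l, φ l * monomialFun (a l) x

theorem analyticGerm_sum {ι : Type*} (s : Finset ι) {q : Fin n → ℂ} {F : ι → (Fin n → ℂ) → ℂ}
    (hF : ∀ i, AnalyticAt ℂ (F i) q) (h : AnalyticAt ℂ (fun x => ∑ i ∈ s, F i x) q) :
    analyticGerm _ h = ∑ i ∈ s, analyticGerm (F i) (hF i) := by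
  classical
  induction s using Finset.induction_on with
  | empty => simp only [Finset.sum_empty]; rfl
  | insert i s hi ih =>
    rw [Finset.sum_insert hi, ← ih (Finset.analyticAt_fun_sum _ fun i _ => hF i)]
    simp only [Finset.sum_insert hi]
    rfl

theorem analyticAt_monomialSum (φ : Fin (n + 2) → ℂ) : AnalyticAt ℂ (monomialSum a φ) 1 :=
  Finset.analyticAt_fun_sum _ fun l _ => analyticAt_const.mul (analyticAt_monomialFun_one (a l))

theorem monomialSum_one (φ : Fin (n + 2) → ℂ) : monomialSum a φ 1 = ∑ l, φ l := by
  simp [monomialSum, monomialFun_one]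

variable (D : CircuitData C a b d)

/-- The local coordinate along the kernel of `C`. -/
noncomputable def param (x : Fin n → ℂ) : ℂ :=
  (monomialSum a D.α x)⁻¹ * monomialSum a D.β x

theorem analyticAt_param : AnalyticAt ℂ D.param 1 :=
  ((analyticAt_monomialSum _).inv (by simp [monomialSum_one, D.sum_α])).mul
    (analyticAt_monomialSum _)

theorem param_one : D.param 1 = 0 := by simp [param, monomialSum_one, D.sum_β]

/-- Modulo the system, the vector of monomials lies in the kernel ⟨1, d⟩ of `C`. Its coordinates
there are the sums with weights α and β, and `param` is their ratio t. -/
theorem isGermIn_monomialFun_sub (j : Fin (n + 2)) : IsGermIn (systemIdeal C a) fun x =>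
    monomialFun (a j) x - monomialSum a D.α x * (1 + D.param x * d j) := by
  have h1 : IsGermIn (systemIdeal C a) fun x => ∑ k, D.E j k * sparseSystem C a k x :=
    IsGermIn.sum _ fun k _ => IsGermIn.const_mul _
      ⟨analyticAt_sparseSystem_one C a k, Ideal.subset_span ⟨k, rfl⟩⟩
  refine h1.congr ?_
  filter_upwards [(analyticAt_monomialSum (a := a) D.α).continuousAt.eventually_ne (y := 0)
    (by simp [monomialSum_one, D.sum_α])] with x hx
  have := D.eq_add_kernel (fun l => monomialFun (a l) x) j
  rw [this]
  change _ = _ + monomialSum a D.α x + monomialSum a D.β x * d j - _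
  simp only [sparseSystem, param]
  field_simp
  ring

theorem isGermIn_log_sub (j : Fin (n + 2)) : IsGermIn (systemIdeal C a) fun x =>
    ∑ i, (a j i : ℂ) * Complex.log (x i) - Complex.log (monomialSum a D.α x)
      - Complex.log (1 + D.param x * d j) := by
  have hs := analyticAt_monomialSum (a := a) D.α
  have hs1 : monomialSum a D.α 1 = 1 := by rw [monomialSum_one, D.sum_α]
  have hp : AnalyticAt ℂ (fun x => 1 + D.param x * d j) 1 :=
    analyticAt_const.add (D.analyticAt_param.mul analyticAt_const)
  have hp1 : 1 + D.param 1 * d j = 1 := by simp [D.param_one]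
  refine ((D.isGermIn_monomialFun_sub j).log_sub_log (analyticAt_monomialFun_one _)
    (hs.fun_mul hp) (monomialFun_one _) (by simp [hs1, hp1])).congr ?_
  filter_upwards [eventually_log_monomialFun (a j),
    eventually_log_mul hs.continuousAt hp.continuousAt hs1 hp1] with x h1 h2
  rw [h1, h2]
  ring

/-- Pairing the logarithmic congruences with -b cancels log x and log s, leaving H(τ). -/
theorem isGermIn_logSum : IsGermIn (systemIdeal C a) fun x => logSum b d (D.param x) := by
  refine (IsGermIn.sum Finset.univ fun j _ =>
    (D.isGermIn_log_sub j).const_mul (-b j)).congr (.of_forall fun x => ?_)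
  simp only [logSum, mul_sub, Finset.sum_sub_distrib, Finset.mul_sum]
  rw [Finset.sum_comm]
  have h1 : ∀ i, ∑ j, -b j * ((a j i : ℂ) * Complex.log (x i)) = 0 := fun i => by
    have : ∀ j, -b j * ((a j i : ℂ) * Complex.log (x i)) =
      b j * (a j i : ℂ) * -Complex.log (x i) := fun j => by ring
    simp only [this, ← Finset.sum_mul, D.sum_b_mul i, zero_mul]
  simp only [h1, ← Finset.sum_mul, Finset.sum_neg_distrib, D.sum_b]
  simp

/-- Once τ is in J, so is each log(1 + τ d_j); pairing with S_i then isolates log x_i, and x_i - 1 =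
exp(log x_i) - 1. -/
theorem isGermIn_coordinate {J : Ideal (analyticGerms (1 : Fin n → ℂ))}
    (hJ : systemIdeal C a ≤ J) (hτ : IsGermIn J D.param) (i : Fin n) :
    IsGermIn J fun x => x i - 1 := by
  have h1 : IsGermIn J fun x => logSum (D.S i) d (D.param x) :=
    hτ.comp (analyticAt_logSum _ _) (logSum_zero _ _) D.param_one
  have h2 := (IsGermIn.sum Finset.univ fun j _ =>
    ((D.isGermIn_log_sub j).mono hJ).const_mul (D.S i j)).add h1
  have h3 : IsGermIn J fun x => Complex.log (x i) := by
    refine h2.congr (.of_forall fun x => ?_)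
    simp only [logSum, mul_sub, Finset.sum_sub_distrib, Finset.mul_sum]
    rw [Finset.sum_comm]
    simp only [← mul_assoc, ← Finset.sum_mul, D.sum_S_mul, D.sum_S]
    simp
  have h4 : AnalyticAt ℂ (fun z : ℂ => Complex.exp z - 1) 0 :=
    analyticAt_cexp.sub analyticAt_const
  refine (h3.comp h4 (by simp) (by simp)).congr ?_
  filter_upwards [(continuous_apply i).continuousAt.eventually_ne (y := 0)
    (by simp : (1 : Fin n → ℂ) i ≠ 0)] with x hx
  rw [Complex.exp_log hx]

theorem multiplicityAtOne_le (D : CircuitData C a b d) {m : ℕ} (hm0 : m ≠ 0) (h : ∀ k < m, ∑ j, b j * d j ^ k = 0)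
    (hm : ∑ j, b j * d j ^ m ≠ 0) : multiplicityAtOne C a ≤ m := by
  refine rank_quotient_le_of_pow_mem (systemIdeal C a) (analyticGerm D.param D.analyticAt_param)
    (fun f => ?_) ?_
  · obtain ⟨f, hf, rfl⟩ := exists_analyticGerm_eq f
    have hτ : IsGermIn (Ideal.span {analyticGerm D.param D.analyticAt_param} ⊔ systemIdeal C a)
        D.param := ⟨D.analyticAt_param, Ideal.mem_sup_left (Ideal.subset_span rfl)⟩
    -- The factor `* 1` matches the constant germ written as `c • 1`.
    obtain ⟨_, h1⟩ := (IsGermIn.sub_apply_of_coordinates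
      (fun i => D.isGermIn_coordinate le_sup_right hτ i) hf).congr
      (g := fun x => f x - f 1 * 1) (.of_forall fun x => by rw [mul_one])
    refine ⟨f 1, ?_⟩
    rw [Algebra.algebraMap_eq_smul_one]
    exact h1
  · obtain ⟨g, hg, hgt⟩ := exists_pow_eq_of_logSum h hm0 hm
    have hg' : AnalyticAt ℂ (fun x => g (D.param x)) 1 :=
      AnalyticAt.fun_comp (by rwa [D.param_one]) D.analyticAt_param
    have ht : Tendsto D.param (𝓝 1) (𝓝 0) := by
      simpa [ContinuousAt, D.param_one] using D.analyticAt_param.continuousAt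
    obtain ⟨_, h1⟩ := (IsGermIn.mul_left hg' D.isGermIn_logSum).congr
      (g := fun x => D.param x ^ m) ((ht.eventually hgt).mono fun x hx => hx.symm)
    exact h1

/-! ### Lower bound by restriction to a curve -/

/-- The approximate solution curve. -/
noncomputable def curve (t : ℂ) (i : Fin n) : ℂ := Complex.exp (logSum (D.S i) d t)

theorem tendsto_curve : Tendsto D.curve (𝓝 0) (𝓝 1) := by
  have h : ContinuousAt D.curve 0 := by
    rw [continuousAt_pi]
    exact fun i => (analyticAt_logSum _ _).continuousAt.cexp
  have h0 : D.curve 0 = 1 := by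
    ext i
    simp [curve]
  rwa [ContinuousAt, h0] at h

/-- Decompose the vector log(1 + t d_k) into an affine function on the configuration plus H(t) e.
The curve realises the linear part, so H is the only obstruction to an exact solution. -/
theorem eventually_monomialFun_curve (j : Fin (n + 2)) : ∀ᶠ t in 𝓝 0,
    monomialFun (a j) (D.curve t) =
      Complex.exp (-logSum D.σ d t) * (1 + t * d j) * Complex.exp (-(D.e j * logSum b d t)) := by
  have hne : ∀ᶠ t in 𝓝 (0 : ℂ), 1 + t * d j ≠ 0 :=
    ContinuousAt.eventually_ne (by fun_prop) (by simp)
  filter_upwards [eventually_monomialFun_exp (a j)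
    (fun i => (analyticAt_logSum (D.S i) d).continuousAt) (fun i => logSum_zero _ _), hne]
    with t ht hne
  have h1 := D.eq_affine_add (fun k => Complex.log (1 + t * d k)) j
  change _ = _ + logSum D.σ d t + D.e j * logSum b d t at h1
  change monomialFun (a j) (fun i => Complex.exp (logSum (D.S i) d t)) = _
  rw [ht]
  conv_rhs => rw [← Complex.exp_log hne, ← Complex.exp_add, ← Complex.exp_add, h1]
  congr 1
  simp only [logSum]
  ring

theorem monomialSum_curve_sub_isBigO {M : ℕ} (h : ∀ k < M, ∑ j, b j * d j ^ k = 0)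
    (φ : Fin (n + 2) → ℂ) :
    (fun t => monomialSum a φ (D.curve t) -
      Complex.exp (-logSum D.σ d t) * (∑ j, φ j + t * ∑ j, φ j * d j)) =O[𝓝 0]
      fun t => t ^ M := by
  have hH := logSum_isBigO h
  have h1 : ∀ j, (fun t => Complex.exp (-(D.e j * logSum b d t)) - 1) =O[𝓝 0]
      fun t => t ^ M := by
    intro j
    have hd : (fun z : ℂ => Complex.exp (-(D.e j * z)) - 1) =O[𝓝 0] fun z => z := by
      have : DifferentiableAt ℂ (fun z : ℂ => Complex.exp (-(D.e j * z))) 0 := by fun_prop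
      simpa using this.isBigO_sub
    have ht : Tendsto (logSum b d) (𝓝 0) (𝓝 0) := by
      simpa [ContinuousAt] using (analyticAt_logSum b d).continuousAt
    exact (hd.comp_tendsto ht).trans hH
  have h2 : ∀ j, (fun t => φ j * (Complex.exp (-logSum D.σ d t) * (1 + t * d j)) *
      (Complex.exp (-(D.e j * logSum b d t)) - 1)) =O[𝓝 0] fun t => t ^ M := by
    intro j
    have hc : ContinuousAt (fun t => φ j * (Complex.exp (-logSum D.σ d t) * (1 + t * d j))) 0 := by
      have := (analyticAt_logSum D.σ d).continuousAt
      fun_prop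
    simpa using (hc.tendsto.isBigO_one ℂ).mul (h1 j)
  refine (IsBigO.sum (s := Finset.univ) fun j _ => h2 j).congr' ?_ .rfl
  filter_upwards [eventually_all.mpr D.eventually_monomialFun_curve] with t ht
  simp only [Finset.sum_apply, monomialSum, ht, Finset.mul_sum, mul_add, ← Finset.sum_add_distrib,
    ← Finset.sum_sub_distrib]
  refine Finset.sum_congr rfl fun j _ => ?_
  ring

/-- Along the curve the α-sum is s and the β-sum is st, both up to O(t^M), with the same unit s. -/
theorem param_curve_sub_isBigO {M : ℕ} (h : ∀ k < M, ∑ j, b j * d j ^ k = 0) :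
    (fun t => D.param (D.curve t) - t) =O[𝓝 0] fun t => t ^ M := by
  have h1 := D.monomialSum_curve_sub_isBigO h D.α
  have h2 := D.monomialSum_curve_sub_isBigO h D.β
  rw [D.sum_α, D.sum_α_mul] at h1
  rw [D.sum_β, D.sum_β_mul] at h2
  have hid : (fun t : ℂ => t) =O[𝓝 0] fun _ => (1 : ℂ) :=
    (continuousAt_id (x := (0 : ℂ))).tendsto.isBigO_one ℂ
  have h3 := h2.sub (by simpa using hid.mul h1)
  have hs : Tendsto (fun t => monomialSum a D.α (D.curve t)) (𝓝 0) (𝓝 1) := by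
    have := (analyticAt_monomialSum (a := a) D.α).continuousAt.tendsto.comp D.tendsto_curve
    rwa [monomialSum_one, D.sum_α] at this
  have h4 := ((hs.inv₀ one_ne_zero).isBigO_one ℂ).mul h3
  refine h4.congr' ?_ (by simp)
  filter_upwards [hs.eventually_ne one_ne_zero] with t ht
  simp only [param]
  field_simp
  ring

theorem isBigO_comp_curve {M : ℕ} (h : ∀ k < M, ∑ j, b j * d j ^ k = 0)
    {f : (Fin n → ℂ) → ℂ} (hf : IsGermIn (systemIdeal C a) f) :
    (fun t => f (D.curve t)) =O[𝓝 0] fun t => t ^ M := by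
  obtain ⟨hfa, hfI⟩ := hf
  -- Quantifying over all representatives of the germ lets the span induction run; generators are
  -- O(t^M) because `C` kills 1 and d.
  suffices ∀ g ∈ systemIdeal C a, ∀ f : (Fin n → ℂ) → ℂ,
      (f : Filter.Germ (𝓝 (1 : Fin n → ℂ)) ℂ) = g →
      (fun t => f (D.curve t)) =O[𝓝 0] fun t => t ^ M from this _ hfI f rfl
  intro g hg
  refine Submodule.span_induction ?_ ?_ ?_ ?_ hg
  · rintro _ ⟨k, rfl⟩ f hf
    have h1 := D.monomialSum_curve_sub_isBigO h (C k)
    rw [D.sum_C, D.sum_C_mul] at h1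
    refine h1.congr' ?_ .rfl
    filter_upwards [D.tendsto_curve.eventually (Filter.Germ.coe_eq.mp hf)] with t ht
    rw [ht]
    simp [monomialSum, sparseSystem]
  · intro f hf
    refine (isBigO_zero _ _).congr' ?_ .rfl
    filter_upwards [D.tendsto_curve.eventually (Filter.Germ.coe_eq.mp hf)] with t ht
    rw [ht]
  · intro x y _ _ hx hy f hf
    obtain ⟨u, hu, rfl⟩ := exists_analyticGerm_eq x
    obtain ⟨v, hv, rfl⟩ := exists_analyticGerm_eq y
    refine ((hx u rfl).add (hy v rfl)).congr' ?_ .rfl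
    have hf' : f =ᶠ[𝓝 1] u + v := Filter.Germ.coe_eq.mp hf
    filter_upwards [D.tendsto_curve.eventually hf'] with t ht
    rw [ht]
    rfl
  · intro x y _ hy f hf
    obtain ⟨u, hu, rfl⟩ := exists_analyticGerm_eq x
    obtain ⟨v, hv, rfl⟩ := exists_analyticGerm_eq y
    have hO := ((hu.continuousAt.tendsto.comp D.tendsto_curve).isBigO_one ℂ).mul (hy v rfl)
    refine hO.congr' ?_ (by simp)
    have hf' : f =ᶠ[𝓝 1] u * v := Filter.Germ.coe_eq.mp hf
    filter_upwards [D.tendsto_curve.eventually hf'] with t ht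
    rw [ht]
    rfl

/-- A relation among 1, τ, …, τ^{M-1} modulo the ideal restricts to a polynomial in t of degree
below M that is O(t^M), hence zero. -/
theorem le_multiplicityAtOne (D : CircuitData C a b d) {M : ℕ} (h : ∀ k < M, ∑ j, b j * d j ^ k = 0) :
    (M : Cardinal) ≤ multiplicityAtOne C a := by
  have hli : LinearIndependent ℂ fun i : Fin M => Ideal.Quotient.mk (systemIdeal C a)
      (analyticGerm D.param D.analyticAt_param) ^ (i : ℕ) := by
    rw [Fintype.linearIndependent_iff]
    intro c hc
    set c' : ℕ → ℂ := fun i => if hi : i < M then c ⟨i, hi⟩ else 0 with hc'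
    suffices ∀ i < M, c' i = 0 by
      intro i
      simpa [hc'] using this i i.2
    have hsum : AnalyticAt ℂ (fun x => ∑ i : Fin M, c i * D.param x ^ (i : ℕ)) 1 :=
      Finset.analyticAt_fun_sum _ fun i _ => analyticAt_const.mul (D.analyticAt_param.pow _)
    have hmem : IsGermIn (systemIdeal C a)
        (fun x => ∑ i : Fin M, c i * D.param x ^ (i : ℕ)) := by
      refine ⟨hsum, ?_⟩
      rw [← Ideal.Quotient.eq_zero_iff_mem, ← hc]
      have : analyticGerm _ hsum =
          ∑ i : Fin M, c i • analyticGerm D.param D.analyticAt_param ^ (i : ℕ) :=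
        analyticGerm_sum _ (fun i => analyticAt_const.mul (D.analyticAt_param.pow _)) hsum
      rw [this, map_sum]
      rfl
    have h1 := D.isBigO_comp_curve h hmem
    have hτ := D.param_curve_sub_isBigO h
    have h2 : ∀ i : Fin M, (fun t => c i * (D.param (D.curve t) ^ (i : ℕ) - t ^ (i : ℕ)))
        =O[𝓝 0] fun t => t ^ M := by
      intro i
      refine IsBigO.const_mul_left ?_ _
      have hτt : Tendsto (fun t => D.param (D.curve t)) (𝓝 0) (𝓝 0) := by
        have := D.analyticAt_param.continuousAt.tendsto.comp D.tendsto_curve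
        rwa [D.param_one] at this
      -- τ^i - t^i is τ - t times this bounded geometric sum.
      have hg : Tendsto (fun t => ∑ k ∈ Finset.range i,
          D.param (D.curve t) ^ k * t ^ ((i : ℕ) - 1 - k)) (𝓝 0)
          (𝓝 (∑ k ∈ Finset.range i, 0 ^ k * 0 ^ ((i : ℕ) - 1 - k))) :=
        tendsto_finsetSum _ fun k _ => (hτt.pow _).mul (tendsto_id.pow _)
      refine ((hg.isBigO_one ℂ).mul hτ).congr (fun t => ?_) (by simp)
      exact (Commute.all _ _).geom_sum₂_mul _
    have h3 := h1.sub (IsBigO.sum (s := Finset.univ) fun i _ => h2 i)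
    refine eq_zero_of_sum_pow_isBigO ((h3.congr_left fun t => ?_).mono nhdsWithin_le_nhds)
    rw [Finset.sum_range, Finset.sum_apply, ← Finset.sum_sub_distrib]
    refine Finset.sum_congr rfl fun i _ => ?_
    simp [hc', mul_sub]
  have := hli.cardinal_le_rank
  rwa [Cardinal.mk_fin] at this

theorem multiplicityAtOne_eq_iff (D : CircuitData C a b d) {m : ℕ} :
    multiplicityAtOne C a = ((m + 1 : ℕ) : Cardinal) ↔
      (∀ k < m + 1, ∑ j, b j * d j ^ k = 0) ∧ ∑ j, b j * d j ^ (m + 1) ≠ 0 := by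
  classical
  constructor
  · intro hmult
    have h1 : ∀ k < m + 1, ∑ j, b j * d j ^ k = 0 := by
      by_contra hcon
      push Not at hcon
      obtain ⟨hk, hk0⟩ := Nat.find_spec hcon
      set k := Nat.find hcon
      have hlt : ∀ l < k, ∑ j, b j * d j ^ l = 0 := fun l hl => by
        have := Nat.find_min hcon hl
        push Not at this
        exact this (hl.trans hk)
      -- The zeroth moment is ∑ b_j = 0, so the upper bound applies at the first nonzero moment.
      have hkne : k ≠ 0 := fun h0 => hk0 (by simp [h0, D.sum_b])
      have := D.multiplicityAtOne_le hkne hlt hk0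
      rw [hmult] at this
      have : m + 1 ≤ k := by exact_mod_cast this
      omega
    refine ⟨h1, fun h2 => ?_⟩
    have := D.le_multiplicityAtOne (M := m + 2) fun k hk => by
      rcases Nat.lt_succ_iff_lt_or_eq.mp hk with hk | rfl
      exacts [h1 k hk, h2]
    rw [hmult] at this
    have : m + 2 ≤ m + 1 := by exact_mod_cast this
    omega
  · rintro ⟨h1, h2⟩
    exact le_antisymm (D.multiplicityAtOne_le (by omega) h1 h2) (D.le_multiplicityAtOne h1)

end CircuitData

/-- If `𝟏` is not a solution, its multiplicity is zero. -/
theorem mulVec_one_eq_zero_of_multiplicityAtOne_ne_zero {n r N : ℕ}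
    {C : Matrix (Fin r) (Fin N) ℂ} {a : Fin N → Fin n → ℝ} (h : multiplicityAtOne C a ≠ 0) :
    C.mulVec 1 = 0 := by
  by_contra hC
  obtain ⟨k, hk⟩ := Function.ne_iff.mp hC
  apply h
  have hval : sparseSystem C a k 1 ≠ 0 := by
    simpa [sparseSystem, monomialFun_one, Matrix.mulVec, dotProduct] using hk
  have hf := analyticAt_sparseSystem_one C a k
  have htop : Ideal.span (Set.range fun k => analyticGerm (sparseSystem C a k)
      (analyticAt_sparseSystem_one C a k)) = ⊤ := by
    rw [Ideal.eq_top_iff_one]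
    obtain ⟨_, h1⟩ := (IsGermIn.mul_left (hf.inv hval)
      (⟨hf, Ideal.subset_span ⟨k, rfl⟩⟩ : IsGermIn (Ideal.span (Set.range fun k =>
        analyticGerm (sparseSystem C a k) (analyticAt_sparseSystem_one C a k))) _)).congr
      (g := fun _ => 1) (by
        filter_upwards [hf.continuousAt.eventually_ne hval] with x hx
        exact inv_mul_cancel₀ hx)
    exact h1
  unfold multiplicityAtOne localMultiplicity
  rw [htop]
  have : Subsingleton (analyticGerms (1 : Fin n → ℂ) ⧸
      (⊤ : Ideal (analyticGerms (1 : Fin n → ℂ)))) := Ideal.Quotient.subsingleton_iff.mpr rfl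
  exact rank_subsingleton' ℂ _

end Circuit

/-! ### Dual bases, affine relations and the moment curve -/

section LinearAlgebra

variable {K : Type*} [Field K] {n : ℕ}

/-- The points `a_j` satisfy no nontrivial affine-linear equation. -/
def AffinelyNondegenerate (a : Fin (n + 2) → Fin n → K) : Prop :=
  ∀ (w : Fin n → K) (c : K), (∀ j, ∑ i, a j i * w i + c = 0) → w = 0

/-- The coefficients of a vector with respect to a basis are linear forms. -/
theorem exists_dual_basis (A : Fin (n + 2) → Fin n → K) (u v : Fin (n + 2) → K)
    (hinj : ∀ (w : Fin n → K) (s t : K), (∀ j, ∑ i, A j i * w i + s * u j + t * v j = 0) →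
      w = 0 ∧ s = 0 ∧ t = 0) :
    ∃ (S : Fin n → Fin (n + 2) → K) (σ ρ : Fin (n + 2) → K),
      ∀ (L : Fin (n + 2) → K) (w : Fin n → K) (s t : K),
        (∀ j, L j = ∑ i, A j i * w i + s * u j + t * v j) ↔
          (∀ i, ∑ k, S i k * L k = w i) ∧ ∑ k, σ k * L k = s ∧ ∑ k, ρ k * L k = t := by
  let f : ((Fin n → K) × K × K) →ₗ[K] (Fin (n + 2) → K) :=
    { toFun := fun p j => ∑ i, A j i * p.1 i + p.2.1 * u j + p.2.2 * v j
      map_add' := fun p q => by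
        ext j
        simp only [Prod.fst_add, Prod.snd_add, Pi.add_apply, mul_add, Finset.sum_add_distrib]
        ring
      map_smul' := fun c p => by
        ext j
        simp only [Prod.smul_fst, Prod.smul_snd, Pi.smul_apply, smul_eq_mul, RingHom.id_apply,
          mul_add, Finset.mul_sum, mul_left_comm, mul_assoc] }
  have hf : Function.Injective f := by
    rw [← LinearMap.ker_eq_bot, LinearMap.ker_eq_bot']
    rintro ⟨w, s, t⟩ h
    obtain ⟨rfl, rfl, rfl⟩ := hinj w s t fun j => congrFun h j
    rfl
  let e := LinearEquiv.ofInjectiveOfFinrankEq f hf (by simp)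
  have he : ∀ p, e p = f p := fun p => rfl
  have hsum : ∀ (φ : (Fin (n + 2) → K) →ₗ[K] K) (L : Fin (n + 2) → K),
      ∑ k, φ (Pi.single k 1) * L k = φ L := fun φ L => by
    conv_rhs => rw [pi_eq_sum_univ' L, map_sum]
    refine Finset.sum_congr rfl fun k _ => ?_
    rw [map_smul, smul_eq_mul, mul_comm]
  let g := (e.symm : (Fin (n + 2) → K) →ₗ[K] ((Fin n → K) × K × K))
  refine ⟨fun i k => (LinearMap.proj i ∘ₗ LinearMap.fst K _ _ ∘ₗ g) (Pi.single k 1),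
    fun k => (LinearMap.fst K _ _ ∘ₗ LinearMap.snd K _ _ ∘ₗ g) (Pi.single k 1),
    fun k => (LinearMap.snd K _ _ ∘ₗ LinearMap.snd K _ _ ∘ₗ g) (Pi.single k 1), fun L w s t => ?_⟩
  simp only [hsum]
  change _ ↔ (∀ i, (e.symm L).1 i = w i) ∧ (e.symm L).2.1 = s ∧ (e.symm L).2.2 = t
  have hmk : ((∀ i, (e.symm L).1 i = w i) ∧ (e.symm L).2.1 = s ∧ (e.symm L).2.2 = t) ↔
      e.symm L = (w, s, t) := by
    rw [Prod.ext_iff, Prod.ext_iff, funext_iff]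
  rw [hmk, LinearEquiv.symm_apply_eq, he, funext_iff]
  rfl

theorem exists_sum_mul_eq_one {b : Fin (n + 2) → K} (hb : b ≠ 0) : ∃ e : Fin (n + 2) → K, ∑ j, b j * e j = 1 := by
  obtain ⟨j, hj⟩ := Function.ne_iff.mp hb
  exact ⟨Pi.single j (b j)⁻¹, by simpa [Pi.single_apply] using mul_inv_cancel₀ hj⟩

theorem sum_affine_eq_zero {a : Fin (n + 2) → Fin n → K} {b : Fin (n + 2) → K}
    (hb : ∑ j, b j = 0) (hba : ∀ i, ∑ j, b j * a j i = 0) (w : Fin n → K) (c : K) :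
    ∑ j, b j * (∑ i, a j i * w i + c) = 0 := by
  simp only [mul_add, Finset.sum_add_distrib, Finset.mul_sum, ← Finset.sum_mul, hb, zero_mul,
    add_zero]
  rw [Finset.sum_comm]
  simp only [← mul_assoc, ← Finset.sum_mul, hba, zero_mul, Finset.sum_const_zero]

/-- With ⟨b, e⟩ = 1, the coordinate functions of a, the constant 1 and e form a basis of K^{n+2}. As
b kills the affine functions, it is itself the coordinate along e. -/
theorem exists_dual_affine {a : Fin (n + 2) → Fin n → K} (ha : AffinelyNondegenerate a)
    {b : Fin (n + 2) → K} (hb0 : b ≠ 0) (hb : ∑ j, b j = 0) (hba : ∀ i, ∑ j, b j * a j i = 0) :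
    ∃ (S : Fin n → Fin (n + 2) → K) (σ e : Fin (n + 2) → K),
      ∀ (L : Fin (n + 2) → K) (w : Fin n → K) (c t : K),
        (∀ j, L j = ∑ i, a j i * w i + c + e j * t) ↔
          (∀ i, ∑ k, S i k * L k = w i) ∧ ∑ k, σ k * L k = c ∧ ∑ k, b k * L k = t := by
  obtain ⟨e, he⟩ := exists_sum_mul_eq_one hb0
  have hbL : ∀ (w : Fin n → K) (c t : K),
      ∑ j, b j * (∑ i, a j i * w i + c + e j * t) = t := fun w c t => by
    simp only [mul_add (b _) (_ + _), Finset.sum_add_distrib, sum_affine_eq_zero hb hba,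
      ← mul_assoc, ← Finset.sum_mul, he]
    ring
  obtain ⟨S, σ, ρ, h⟩ := exists_dual_basis a (fun _ => 1) e fun w s t h => by
    have ht : t = 0 := by
      rw [← hbL w s t]
      refine Finset.sum_eq_zero fun j _ => ?_
      have := h j
      rw [mul_one, mul_comm t] at this
      rw [this, mul_zero]
    subst ht
    have hw : w = 0 := ha w s fun j => by simpa using h j
    subst hw
    exact ⟨rfl, by simpa using h 0, rfl⟩
  have hρ : ∀ L : Fin (n + 2) → K, ∑ k, ρ k * L k = ∑ k, b k * L k := fun L => by
    have := (h L _ _ _).mpr ⟨fun i => rfl, rfl, rfl⟩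
    conv_rhs => enter [2, k]; rw [this k, mul_one, mul_comm _ (e k)]
    rw [hbL]
  refine ⟨S, σ, e, fun L w c t => ?_⟩
  rw [← hρ, ← h]
  simp only [mul_one, mul_comm (e _)]

/-- A configuration of `n + 2` points in `Kⁿ` has a nontrivial affine relation. -/
theorem exists_affine_relation (a : Fin (n + 2) → Fin n → K) :
    ∃ b : Fin (n + 2) → K, b ≠ 0 ∧ ∑ j, b j = 0 ∧ ∀ i, ∑ j, b j * a j i = 0 := by
  let f : (Fin (n + 2) → K) →ₗ[K] K × (Fin n → K) :=
    (∑ j, LinearMap.proj j).prod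
      (LinearMap.pi fun i => ∑ j, a j i • LinearMap.proj j)
  obtain ⟨b, hb, hb0⟩ := Submodule.exists_mem_ne_zero_of_ne_bot
    (LinearMap.ker_ne_bot_of_finrank_lt (f := f) (by simp; omega))
  have hf : f b = 0 := hb
  refine ⟨b, hb0, ?_, fun i => ?_⟩
  · simpa [f] using congrArg Prod.fst hf
  · simpa [f, mul_comm] using congrFun (congrArg Prod.snd hf) i

/-- By rank-nullity the kernel has dimension at least 2, too large for the line of constant vectors.
-/
theorem exists_kernel_vector {C : Matrix (Fin n) (Fin (n + 2)) K} :
    ∃ d : Fin (n + 2) → K, C.mulVec d = 0 ∧ ∃ i j, d i ≠ d j := by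
  by_contra! h
  have h1 := C.mulVecLin.finrank_range_add_finrank_ker
  have h2 : Module.finrank K C.mulVecLin.range ≤ n := by
    simpa using Submodule.finrank_le C.mulVecLin.range
  have h3 : C.mulVecLin.ker ≤ Submodule.span K {1} := fun d hd => by
    rw [Submodule.mem_span_singleton]
    refine ⟨d 0, ?_⟩
    ext i
    simpa using h d hd 0 i
  have h4 := (Submodule.finrank_mono h3).trans (finrank_span_le_card {(1 : Fin (n + 2) → K)})
  rw [Module.finrank_fin_fun] at h1
  rw [Set.toFinset_singleton, Finset.card_singleton] at h4
  omega

theorem exists_right_inverse_of_rank_eq {m : ℕ} {C : Matrix (Fin n) (Fin m) K} (h : C.rank = n) :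
    ∃ B : Matrix (Fin m) (Fin n) K, C * B = 1 := by
  rw [← Matrix.mulVec_surjective_iff_exists_right_inverse]
  have : C.mulVecLin.range = ⊤ := Submodule.eq_top_of_finrank_eq (by
    rw [Module.finrank_fin_fun]
    exact h)
  exact LinearMap.range_eq_top.mp this

/-- The columns of the right inverse E together with 1 and d form a basis, and `C` itself reads off
the E-coordinates. -/
theorem exists_dual_kernel {C : Matrix (Fin n) (Fin (n + 2)) K} {E : Matrix (Fin (n + 2)) (Fin n) K}
    (hE : C * E = 1) (hC : C.mulVec 1 = 0) {d : Fin (n + 2) → K} (hd : C.mulVec d = 0)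
    (hd' : ∃ i j, d i ≠ d j) :
    ∃ α β : Fin (n + 2) → K, ∀ (z : Fin (n + 2) → K) (w : Fin n → K) (s t : K),
        (∀ j, z j = ∑ k, E j k * w k + s + t * d j) ↔
          (∀ k, ∑ l, C k l * z l = w k) ∧ ∑ l, α l * z l = s ∧ ∑ l, β l * z l = t := by
  have hCz : ∀ (w : Fin n → K) (s t : K),
      C.mulVec (fun j => ∑ k, E j k * w k + s * 1 + t * d j) = w := fun w s t => by
    have : (fun j => ∑ k, E j k * w k + s * 1 + t * d j) = E.mulVec w + s • 1 + t • d := by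
      ext j
      simp [Matrix.mulVec, dotProduct]
    rw [this, Matrix.mulVec_add, Matrix.mulVec_add, Matrix.mulVec_smul, Matrix.mulVec_smul, hC, hd,
      Matrix.mulVec_mulVec, hE, Matrix.one_mulVec]
    simp
  obtain ⟨S, α, β, h⟩ := exists_dual_basis (fun j k => E j k) (fun _ => 1) d fun w s t h => by
    have hw : w = 0 := by
      rw [← hCz w s t]
      simp only [h]
      exact Matrix.mulVec_zero C
    subst hw
    obtain ⟨i, j, hij⟩ := hd'
    have hi := h i
    have hj := h j
    simp only [Pi.zero_apply, mul_zero, Finset.sum_const_zero, zero_add, mul_one] at hi hj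
    have ht : t = 0 := by
      have : t * (d i - d j) = 0 := by linear_combination hi - hj
      exact (mul_eq_zero.mp this).resolve_right (sub_ne_zero.mpr hij)
    subst ht
    exact ⟨rfl, by simpa using hi, rfl⟩
  have hS : ∀ (z : Fin (n + 2) → K) k, ∑ l, S k l * z l = ∑ l, C k l * z l := fun z k => by
    have := (h z _ _ _).mpr ⟨fun i => rfl, rfl, rfl⟩
    have h2 := congrFun (hCz (fun i => ∑ l, S i l * z l) (∑ k, α k * z k) (∑ k, β k * z k)) k
    rw [← funext this] at h2
    exact h2.symm
  refine ⟨α, β, fun z w s t => ?_⟩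
  simp only [← hS, ← h, mul_one]

theorem nonempty_circuitData {C : Matrix (Fin n) (Fin (n + 2)) ℂ}
    {E : Matrix (Fin (n + 2)) (Fin n) ℂ} (hE : C * E = 1) (hC : C.mulVec 1 = 0)
    {d : Fin (n + 2) → ℂ} (hd : C.mulVec d = 0) (hd' : ∃ i j, d i ≠ d j)
    {a : Fin (n + 2) → Fin n → ℝ} (ha : AffinelyNondegenerate fun j i => (a j i : ℂ))
    {b : Fin (n + 2) → ℂ} (hb0 : b ≠ 0) (hb : ∑ j, b j = 0)
    (hba : ∀ i, ∑ j, b j * (a j i : ℂ) = 0) : Nonempty (CircuitData C a b d) := by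
  obtain ⟨α, β, hαβ⟩ := exists_dual_kernel hE hC hd hd'
  obtain ⟨S, σ, e, hS⟩ := exists_dual_affine ha hb0 hb hba
  have h1 := (hαβ (fun _ => 1) 0 1 0).mp (by simp)
  have h2 := (hαβ d 0 0 1).mp (by simp)
  have h3 := (hS (fun _ => 1) 0 1 0).mp (by simp)
  have h4 := fun l => (hS (fun j => (a j l : ℂ)) (Pi.single l 1) 0 0).mp
    (by simp [Pi.single_apply])
  simp only [mul_one, Pi.zero_apply] at h1 h2 h3
  exact ⟨{
    E := E, α := α, β := β, S := S, σ := σ, e := e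
    sum_C := h1.1
    sum_C_mul := h2.1
    sum_α := h1.2.1
    sum_α_mul := h2.2.1
    sum_β := h1.2.2
    sum_β_mul := h2.2.2
    eq_add_kernel := fun z => (hαβ z _ _ _).mpr ⟨fun _ => rfl, rfl, rfl⟩
    sum_b := hb
    sum_b_mul := hba
    sum_S := h3.1
    sum_S_mul := fun i l => by rw [(h4 l).1 i, Pi.single_apply]
    eq_affine_add := fun L => (hS L _ _ _).mpr ⟨fun _ => rfl, rfl, rfl⟩ }⟩

theorem affinelyNondegenerate_of_affineSpan_eq_top {a : Fin (n + 2) → Fin n → K}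
    (h : affineSpan K (Set.range a) = ⊤) : AffinelyNondegenerate a := by
  intro w c hw
  let f : (Fin n → K) →ᵃ[K] K :=
    (∑ i, w i • LinearMap.proj (R := K) (φ := fun _ : Fin n => K) i).toAffineMap +
      AffineMap.const K _ c
  have hf : ∀ x, f x = ∑ i, x i * w i + c := fun x => by simp [f, mul_comm]
  have h0 : f = AffineMap.const K _ 0 := AffineMap.ext_on h (by
    rintro _ ⟨j, rfl⟩
    rw [hf, hw j]
    rfl)
  ext i
  have h1 : f (Pi.single i 1) = 0 := by rw [h0]; rfl
  have h2 : f 0 = 0 := by rw [h0]; rfl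
  rw [hf] at h1 h2
  have hc : c = 0 := by simpa using h2
  simpa [Pi.single_apply, hc] using h1

theorem AffinelyNondegenerate.ofReal {a : Fin (n + 2) → Fin n → ℝ}
    (h : AffinelyNondegenerate a) : AffinelyNondegenerate fun j i => (a j i : ℂ) := by
  intro w c hw
  have hre := h (fun i => (w i).re) c.re fun j => by
    simpa using congrArg Complex.re (hw j)
  have him := h (fun i => (w i).im) c.im fun j => by
    simpa using congrArg Complex.im (hw j)
  ext i
  exact Complex.ext (congrFun hre i) (congrFun him i)

theorem sum_eval_eq_zero {b d : Fin (n + 2) → K} {m : ℕ}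
    (h : ∀ k < m, ∑ j, b j * d j ^ k = 0) (p : Polynomial K) (hp : p.natDegree ≤ m) :
    ∑ j, b j * p.eval (d j) = p.coeff m * ∑ j, b j * d j ^ m := by
  simp only [Polynomial.eval_eq_sum_range' (Nat.lt_succ_of_le hp), Finset.mul_sum]
  rw [Finset.sum_comm, Finset.sum_range_succ, Finset.sum_eq_zero, zero_add]
  · exact Finset.sum_congr rfl fun j _ => by ring
  · intro k hk
    trans p.coeff k * ∑ j, b j * d j ^ k
    · rw [Finset.mul_sum]
      exact Finset.sum_congr rfl fun j _ => by ring
    · rw [h k (Finset.mem_range.mp hk), mul_zero]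

/-- If d_i = d_j, the monic polynomial of degree n+1 with roots d_l for l ≠ i vanishes at every
node; pairing it with b gives moment n+1 equal to zero. -/
theorem injective_of_moments {b d : Fin (n + 2) → K}
    (h : ∀ k < n + 1, ∑ j, b j * d j ^ k = 0) (hne : ∑ j, b j * d j ^ (n + 1) ≠ 0) :
    Function.Injective d := by
  intro i j hij
  by_contra hne'
  let s := Finset.univ.erase i
  let p : Polynomial K := ∏ l ∈ s, (Polynomial.X - Polynomial.C (d l))
  have hdeg : p.natDegree = n + 1 := by
    rw [Polynomial.natDegree_finsetProd_X_sub_C_eq_card]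
    simp [s]
  have hmonic : p.Monic := Polynomial.monic_prod_of_monic _ _ fun l _ => Polynomial.monic_X_sub_C _
  have hcoeff : p.coeff (n + 1) = 1 := by rw [← hdeg]; exact hmonic
  have hroot : ∀ l, p.eval (d l) = 0 := by
    have : ∀ l ∈ s, p.eval (d l) = 0 := fun l hl => by
      rw [Polynomial.eval_prod]
      exact Finset.prod_eq_zero hl (by simp)
    intro l
    by_cases hl : l = i
    · rw [hl, hij]
      exact this j (by simp [s, Ne.symm hne'])
    · exact this l (by simp [s, hl])
  have := sum_eval_eq_zero h p hdeg.le
  rw [hcoeff, one_mul] at this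
  exact hne (by rw [← this]; simp [hroot])

/-- The moments of the affine relation of a nondegenerate configuration of `n + 2` points detect
whether the configuration is affinely equivalent to points on the moment curve. -/
theorem moments_iff_affinelyEquivalent {a : Fin (n + 2) → Fin n → K}
    (ha : AffinelyNondegenerate a) {b : Fin (n + 2) → K} (hb0 : b ≠ 0) (hb : ∑ j, b j = 0)
    (hba : ∀ i, ∑ j, b j * a j i = 0) (d : Fin (n + 2) → K) :
    ((∀ k < n + 1, ∑ j, b j * d j ^ k = 0) ∧ ∑ j, b j * d j ^ (n + 1) ≠ 0) ↔
      Function.Injective d ∧ AffinelyEquivalent a (fun j => momentCurve n (d j)) := by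
  constructor
  · rintro ⟨h, hne⟩
    have hinj := injective_of_moments h hne
    refine ⟨hinj, ?_⟩
    obtain ⟨S, σ, e, hS⟩ := exists_dual_affine ha hb0 hb hba
    have hrep : ∀ k : Fin n, ∃ (w : Fin n → K) (c : K),
        ∀ j, d j ^ ((k : ℕ) + 1) = ∑ i, a j i * w i + c := fun k => by
      have := (hS (fun j => d j ^ ((k : ℕ) + 1)) _ _ _).mpr
        ⟨fun _ => rfl, rfl, h _ (by omega)⟩
      exact ⟨_, _, fun j => by rw [this j, mul_zero, add_zero]⟩
    choose W c hW using hrep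
    -- A left kernel vector v of W gives a polynomial ∑ v_k (t^{k+1} - c_k) of degree at most n
    -- vanishing at n+1 distinct nodes, so v = 0.
    have hdet : (Matrix.of W).det ≠ 0 := by
      rw [Ne, ← Matrix.exists_vecMul_eq_zero_iff]
      rintro ⟨v, hv0, hv⟩
      have hv' : ∀ i, ∑ k, v k * W k i = 0 := fun i => congrFun hv i
      have hz := Matrix.eq_zero_of_forall_index_sum_pow_mul_eq_zero
        (f := fun j : Fin (n + 1) => d j.castSucc)
        (v := Fin.cons (-∑ k, v k * c k) v)
        (hinj.comp (Fin.castSucc_injective _)) fun j => by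
          rw [Fin.sum_univ_succ]
          simp only [Fin.cons_zero, Fin.cons_succ, Fin.val_zero, pow_zero, one_mul, Fin.val_succ,
            hW, add_mul, Finset.sum_add_distrib, Finset.sum_mul]
          rw [Finset.sum_comm]
          have : ∀ i, ∑ k, a j.castSucc i * W k i * v k = 0 := fun i => by
            rw [← mul_zero (a j.castSucc i), ← hv' i, Finset.mul_sum]
            exact Finset.sum_congr rfl fun k _ => by ring
          simp only [this, Finset.sum_const_zero, mul_comm (c _)]
          ring
      apply hv0
      ext k
      simpa using congrFun hz k.succ
    let e := Matrix.toLinearEquiv' (Matrix.of W) (Matrix.invertibleOfIsUnitDet _ hdet.isUnit)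
    refine ⟨e.toAffineEquiv.trans (AffineEquiv.constVAdd K (Fin n → K) c), fun j => ?_⟩
    ext k
    have he : e (a j) = (Matrix.of W).mulVec (a j) := rfl
    simp only [AffineEquiv.trans_apply, LinearEquiv.coe_toAffineEquiv, AffineEquiv.constVAdd_apply,
      he, vadd_eq_add, Pi.add_apply, momentCurve, hW, Matrix.mulVec, dotProduct, Matrix.of_apply]
    rw [add_comm]
    simp only [mul_comm]
  · rintro ⟨hinj, T, hT⟩
    have h : ∀ k < n + 1, ∑ j, b j * d j ^ k = 0 := by
      intro k hk
      rcases k with _ | k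
      · simpa using hb
      · have hk' : k < n := by omega
        have hdec : ∀ j, T (a j) = T.linear (a j) + T 0 := fun j => by
          have := T.map_vadd 0 (a j)
          rwa [vadd_eq_add, vadd_eq_add, add_zero] at this
        have hsum : T.linear (∑ j, b j • a j) = 0 := by
          have : ∑ j, b j • a j = 0 := by
            ext i
            simpa using hba i
          rw [this, map_zero]
        have h1 : ∑ j, b j • T (a j) = 0 := by
          simp only [hdec, smul_add, Finset.sum_add_distrib, ← Finset.sum_smul, hb, zero_smul,
            add_zero]
          rw [← hsum, map_sum]
          simp only [map_smul]
        simp only [hT] at h1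
        simpa [momentCurve] using congrFun h1 ⟨k, hk'⟩
    refine ⟨h, fun h0 => hb0 ?_⟩
    -- With n+2 distinct nodes, vanishing of moments 0 to n+1 would force b = 0 by Vandermonde.
    refine Matrix.eq_zero_of_forall_pow_sum_mul_pow_eq_zero hinj fun k => ?_
    rcases Nat.lt_succ_iff_lt_or_eq.mp k.2 with hk | hk
    · exact h k hk
    · rw [hk]
      exact h0

end LinearAlgebra

/-! ### The complex and real statements -/

theorem mainTheorem10 (n : ℕ) (a : Fin (n + 2) → Fin n → ℝ) (ha : Function.Injective a)
    (hdim : affineSpan ℝ (Set.range a) = ⊤) :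
    (∀ C : Matrix (Fin n) (Fin (n + 2)) ℂ, C.rank = n →
      (multiplicityAtOne C a = ((n + 1 : ℕ) : Cardinal) ↔
        C.mulVec 1 = 0 ∧
        ∃ d : Fin (n + 2) → ℂ, C.mulVec d = 0 ∧ Function.Injective d ∧
          AffinelyEquivalent (fun j i => (a j i : ℂ)) (fun j => momentCurve n (d j)))) ∧
    (∀ C : Matrix (Fin n) (Fin (n + 2)) ℝ, C.rank = n →
      (multiplicityAtOne (C.map Complex.ofReal) a = ((n + 1 : ℕ) : Cardinal) ↔
        C.mulVec 1 = 0 ∧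
        ∃ d : Fin (n + 2) → ℝ, C.mulVec d = 0 ∧ Function.Injective d ∧
          AffinelyEquivalent a (fun j => momentCurve n (d j)))) := by
  have hR := affinelyNondegenerate_of_affineSpan_eq_top hdim
  have hc := hR.ofReal
  obtain ⟨b, hb0, hb, hba⟩ := exists_affine_relation a
  have hcb0 : (fun j => (b j : ℂ)) ≠ 0 := fun h => hb0 (by
    ext j
    simpa using congrFun h j)
  have hcb : ∑ j, (b j : ℂ) = 0 := by exact_mod_cast congrArg Complex.ofReal hb
  have hcba : ∀ i, ∑ j, (b j : ℂ) * (a j i : ℂ) = 0 := fun i => by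
    exact_mod_cast congrArg Complex.ofReal (hba i)
  constructor
  · intro C hC
    obtain ⟨E, hE⟩ := exists_right_inverse_of_rank_eq hC
    constructor
    · intro hmult
      have h1 := mulVec_one_eq_zero_of_multiplicityAtOne_ne_zero (C := C) (a := a) (by
        rw [hmult]
        exact_mod_cast Nat.succ_ne_zero n)
      obtain ⟨d, hd, hd'⟩ := exists_kernel_vector (C := C)
      obtain ⟨D⟩ := nonempty_circuitData hE h1 hd hd' hc hcb0 hcb hcba
      exact ⟨h1, d, hd, (moments_iff_affinelyEquivalent hc hcb0 hcb hcba d).mp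
        (D.multiplicityAtOne_eq_iff.mp hmult)⟩
    · rintro ⟨h1, d, hd, hinj, haff⟩
      obtain ⟨D⟩ := nonempty_circuitData hE h1 hd
        ⟨0, 1, hinj.ne (by simp)⟩ hc hcb0 hcb hcba
      exact D.multiplicityAtOne_eq_iff.mpr
        ((moments_iff_affinelyEquivalent hc hcb0 hcb hcba d).mpr ⟨hinj, haff⟩)
  · intro C hC
    obtain ⟨E, hE⟩ := exists_right_inverse_of_rank_eq hC
    have hE' : C.map Complex.ofReal * E.map Complex.ofReal = 1 := by
      have := congrArg (fun M => M.map Complex.ofRealHom) hE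
      simp only [Matrix.map_mul] at this
      rw [Matrix.map_one _ (map_zero _) (map_one _)] at this
      exact this
    have hmap : ∀ d : Fin (n + 2) → ℝ, (C.map Complex.ofReal).mulVec (fun j => (d j : ℂ)) = 0 ↔
        C.mulVec d = 0 := fun d => by
      simp only [funext_iff, Matrix.mulVec, dotProduct, Matrix.map_apply, Pi.zero_apply]
      exact forall_congr' fun k => by exact_mod_cast Iff.rfl
    have hmap1 : (C.map Complex.ofReal).mulVec 1 = 0 ↔ C.mulVec 1 = 0 := by
      rw [← hmap 1]
      simp [Pi.one_def]
    have hmom : ∀ (d : Fin (n + 2) → ℝ) (k : ℕ),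
        ∑ j, (b j : ℂ) * (d j : ℂ) ^ k = 0 ↔ ∑ j, b j * d j ^ k = 0 := fun d k => by
      exact_mod_cast Iff.rfl
    -- The relation b is real, and a real nonconstant kernel vector d also serves over ℂ. So the
    -- complex multiplicity is decided by real moments, which the real moment-curve criterion
    -- interprets.
    have key : ∀ d : Fin (n + 2) → ℝ, C.mulVec 1 = 0 → C.mulVec d = 0 → (∃ i j, d i ≠ d j) →
        (multiplicityAtOne (C.map Complex.ofReal) a = ((n + 1 : ℕ) : Cardinal) ↔
          Function.Injective d ∧ AffinelyEquivalent a (fun j => momentCurve n (d j))) := by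
      intro d h1 hd hd'
      obtain ⟨D⟩ := nonempty_circuitData (d := fun j => (d j : ℂ)) hE' (hmap1.mpr h1)
        ((hmap d).mpr hd) (by exact_mod_cast hd') hc hcb0 hcb hcba
      rw [D.multiplicityAtOne_eq_iff, ← moments_iff_affinelyEquivalent hR hb0 hb hba d]
      simp only [ne_eq, hmom]
    constructor
    · intro hmult
      have h1 := hmap1.mp (mulVec_one_eq_zero_of_multiplicityAtOne_ne_zero (a := a) (by
        rw [hmult]
        exact_mod_cast Nat.succ_ne_zero n))
      obtain ⟨d, hd, hd'⟩ := exists_kernel_vector (C := C)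
      exact ⟨h1, d, hd, (key d h1 hd hd').mp hmult⟩
    · rintro ⟨h1, d, hd, h⟩
      exact (key d h1 hd ⟨0, 1, h.1.ne (by simp)⟩).mpr h
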